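/- Let $\Omega=\{0,1\}^{\mathbb N}$ be the Cantor space and, for a finite bit string $x$, let $x\Omega$ be the set of sequences with prefix $x$. A probability measure $P$ on $\Omega$ is \emph{computable} if there is an algorithm that, given $x$ and a rational $\varepsilon>0$, returns a rational $\varepsilon$-approximation to $P(x\Omega)$. A \emph{Martin-Löf test} for $P$ is a decreasing sequence $U_0\supseteq U_1\supseteq U_2\supseteq\dots$ of uniformly effectively open subsets of $\Omega$ (an algorithm, given $n$, enumerates strings $x$ such that $U_n$ is the union of the corresponding sets $x\Omega$) with $P(U_n)\le 2^{-n}$ for all $n$. A sequence $\omega\in\Omega$ is \emph{$P$-random} (Martin-Löf random with respect to $P$) if for every Martin-Löf test $(U_n)$ for $P$ there is some $n$ with $\omega\notin U_n$. A mapping $F$ from the set of $P$-random sequences to $\Omega$ is \emph{layerwise computable} (with respect to $P$) if there exist a Martin-Löf test $(U_n)$ for $P$ and a machine $M$ such that, for every $i$ and every $P$-random $\omega\notin U_i$, the machine $M$, given the number $i$ and the sequence $\omega$ on its read-only input tape, prints exactly the infinite sequence $F(\omega)$ bit by bit on its write-only output tape. (Nothing is required of $M$ on other inputs.) Theorem.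 Let $P$ be a computable probability measure on $\Omega$, and let $F$ be a layerwise computable mapping from the set of $P$-random sequences to $\Omega$. Then, for every Borel set $X\subseteq\Omega$, the set $F^{-1}(X)$ of all $P$-random $\omega$ with $F(\omega)\in X$ is Borel, and $Q(X)=P(F^{-1}(X))$ defines a Borel probability measure $Q$ on $\Omega$. Moreover: (i) the measure $Q$ is computable; (ii) if $\alpha$ is $P$-random, then $F(\alpha)$ is $Q$-random; (iii) if $\beta$ is $Q$-random, then there exists a $P$-random $\alpha$ with $F(\alpha)=\beta$. -/

import Mathlib

open MeasureTheory

open scoped ENNReal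

namespace ImageRandomness

/-- The Cantor space of infinite bit sequences (with its product topology and Borel σ-algebra). -/
abbrev Cantor : Type := ℕ → Bool

/-- The interval `xΩ`: all infinite sequences that have the finite string `x` as a prefix. -/
def cyl (x : List Bool) : Set Cantor :=
  {ω | ∀ (k : ℕ) (hk : k < x.length), ω k = x[k]}

/-- A distribution `P` is computable if some algorithm, given a string `x` and a rational
`ε = (a + 1) / (b + 1) > 0`, returns a rational `c / (d + 1)` that is an `ε`-approximation to
`P(xΩ)`.  Rationals are handled through numerators and denominators; a negative approximation
could always be replaced by `0`, so natural numerators suffice. -/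
def IsComputableDistribution (P : Measure Cantor) : Prop :=
  ∃ f : List Bool × ℕ × ℕ → ℕ × ℕ, Computable f ∧
    ∀ (x : List Bool) (a b : ℕ),
      |P.real (cyl x) - ((f (x, a, b)).1 : ℝ) / (((f (x, a, b)).2 : ℝ) + 1)|
        ≤ ((a : ℝ) + 1) / ((b : ℝ) + 1)

/-- The sets `U n` are uniformly effectively open: some algorithm, given `n`, enumerates a (finite
or infinite, possibly empty) list of strings `x` such that `U n` is the union of the intervals
`xΩ`. -/
def UniformlyEffectivelyOpen (U : ℕ → Set Cantor) : Prop :=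
  ∃ W : ℕ × List Bool → Prop, REPred W ∧
    ∀ n, U n = ⋃ (x : List Bool) (_ : W (n, x)), cyl x

/-- Martin-Löf tests for `P`: decreasing sequences of uniformly effectively open sets with
`P (U n) ≤ 2⁻ⁿ`.  The numbering starts from `0`; since `P (U 0) ≤ 1` is no restriction for a
probability distribution, a test numbered from `1` becomes one by putting `U 0 = Ω`. -/
structure IsMLTest (P : Measure Cantor) (U : ℕ → Set Cantor) : Prop where
  antitone : Antitone U
  effectivelyOpen : UniformlyEffectivelyOpen U
  measure_le : ∀ n, P (U n) ≤ (2⁻¹ : ℝ≥0∞) ^ n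

/-- `ω` is Martin-Löf random with respect to `P` if no Martin-Löf test rejects it. -/
def IsMLRandom (P : Measure Cantor) (ω : Cantor) : Prop :=
  ∀ U : ℕ → Set Cantor, IsMLTest P U → ∃ n, ω ∉ U n

/-- A machine with a number as finite input, a read-only infinite input tape and a write-only
one-directional output tape.  A configuration (control state, positions of the heads, content of
the work tapes) is coded by a natural number.  In a configuration `c` the machine reads the cell
`pos c` of the input tape; depending on the bit found there it passes to the next configuration
and possibly prints one more bit on the output tape. -/
structure Machine where
  init : ℕ → ℕ
  pos : ℕ → ℕ
  next : ℕ → Bool → ℕ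
  emit : ℕ → Bool → Option Bool
  init_computable : Computable init
  pos_computable : Computable pos
  next_computable : Computable₂ next
  emit_computable : Computable₂ emit

/-- The configuration after `t` steps, on input number `i` and input tape `ω`. -/
def Machine.config (M : Machine) (i : ℕ) (ω : Cantor) : ℕ → ℕ
  | 0 => M.init i
  | t + 1 => M.next (M.config i ω t) (ω (M.pos (M.config i ω t)))

/-- The content of the output tape after `t` steps. -/
def Machine.output (M : Machine) (i : ℕ) (ω : Cantor) : ℕ → List Bool
  | 0 => []
  | t + 1 =>
    M.output i ω t ++ (M.emit (M.config i ω t) (ω (M.pos (M.config i ω t)))).toList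

/-- On input number `i` and input tape `ω` the machine prints, bit by bit, exactly the infinite
sequence `β`. -/
def Machine.Computes (M : Machine) (i : ℕ) (ω β : Cantor) : Prop :=
  (∀ t, β ∈ cyl (M.output i ω t)) ∧ ∀ n, ∃ t, n ≤ (M.output i ω t).length

/-- A mapping `F`, defined on the `P`-random sequences, is layerwise computable if there are a
Martin-Löf test `U` and one machine that, given `i` and a sequence `ω ∉ U i` in the domain of `F`,
prints `F ω`.  Nothing is required of the machine on other inputs. -/
def IsLayerwiseComputable (P : Measure Cantor) (F : {ω : Cantor // IsMLRandom P ω} → Cantor) :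
    Prop :=
  ∃ (U : ℕ → Set Cantor) (M : Machine), IsMLTest P U ∧
    ∀ (i : ℕ) (ω : {ω : Cantor // IsMLRandom P ω}), ω.1 ∉ U i → M.Computes i ω.1 (F ω)

/-- The set `F⁻¹(X)`, as a subset of the Cantor space. -/
def preimageSet {P : Measure Cantor} (F : {ω : Cantor // IsMLRandom P ω} → Cantor)
    (X : Set Cantor) : Set Cantor :=
  {ω | ∃ h : IsMLRandom P ω, F ⟨ω, h⟩ ∈ X}

/-- The image distribution: restrict `P` to the `P`-random sequences and push it forward along
`F`. -/
noncomputable def imageDistribution (P : Measure Cantor)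
    (F : {ω : Cantor // IsMLRandom P ω} → Cantor) : Measure Cantor :=
  (P.comap (Subtype.val : {ω : Cantor // IsMLRandom P ω} → Cantor)).map F

end ImageRandomness

/-!
The image of a computable distribution `P` under a layerwise computable mapping `F`, given by a
test `U` and a machine `M`.

Everything is reduced to decidable properties of finite strings.  Uniformly effectively open sets
are the sets `{ω | ∃ m, B n (ω|m)}` with `B` computable and inherited by extensions
(`UniformlyEffectivelyOpen.exists_decidable`), `M` is replaced by the monotone computable function
`Machine.sim` from strings to strings, and the `P`-measure of an event depending on the first `s`
bits is computed by summing over the strings of length `s`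
(`IsComputableDistribution.exists_approx`).

Two facts on tests are used throughout.  If `P (G k) ≤ 2 ^ C * 2⁻ᵏ` for uniformly effectively open
sets `G k`, not necessarily decreasing, then a random sequence lies in finitely many of them only
(`IsMLRandom.eventually_notMem`).  There is a universal test up to the factor `2`, obtained by
trimming all enumerations to small measure (`IsComputableDistribution.exists_universal`); so the
random sequences form a Borel set of measure one.

* Computability of the image: outside `U i`, of measure at most `2⁻ⁱ`, the machine with input `i`
  prints `F ω`.  Waiting until it has printed enough bits on a set of measure almost `1 - 2⁻ⁱ`, an
  event one recognizes by computing measures, and then measuring the clopen set where the output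
  extends `x` gives the measure of `F⁻¹(xΩ)` up to `O(2⁻ⁱ)`.
* Images of random sequences are random: a test `V` for the image pulls back to the sets on which
  the output of `M` on input `k` gets into `V k`.  Their measure is at most `P (F⁻¹(V k)) + P (U k)`,
  and since `U` is decreasing they catch every `α` whose image is in all `V k`.
* Random sequences are images: let `K i` be the complement of the union of `U i` and the `i`-th
  set of the universal test.  This is a compact set of random sequences on which `F` is computed by
  `M`, so the complement of `F(K i)` is effectively open, uniformly in `i`, and its image measure is
  at most `3 * 2⁻ⁱ`.  A random `β` avoids one of these complements, so it lies in `F(K i)`.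
-/

/-! ### Closure properties of computable functions -/

namespace Computable

variable {α σ : Type*} [Primcodable α] [Primcodable σ]

theorem natAdd {f g : α → ℕ} (hf : Computable f) (hg : Computable g) :
    Computable fun a => f a + g a :=
  Primrec.nat_add.to_comp.comp hf hg

theorem natSub {f g : α → ℕ} (hf : Computable f) (hg : Computable g) :
    Computable fun a => f a - g a :=
  Primrec.nat_sub.to_comp.comp hf hg

theorem natMul {f g : α → ℕ} (hf : Computable f) (hg : Computable g) :
    Computable fun a => f a * g a :=
  Primrec.nat_mul.to_comp.comp hf hg

theorem natDiv {f g : α → ℕ} (hf : Computable f) (hg : Computable g) :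
    Computable fun a => f a / g a :=
  Primrec.nat_div.to_comp.comp hf hg

theorem twoPow {f : α → ℕ} (hf : Computable f) : Computable fun a => 2 ^ f a :=
  (Primrec₂.unpaired'.1 Nat.Primrec.pow).to_comp.comp (const 2) hf

theorem decideLE {f g : α → ℕ} (hf : Computable f) (hg : Computable g) :
    Computable fun a => decide (f a ≤ g a) :=
  Primrec.nat_le.decide.to_comp.comp hf hg

theorem decideEq [DecidableEq σ] {f g : α → σ} (hf : Computable f) (hg : Computable g) :
    Computable fun a => decide (f a = g a) :=
  Primrec.eq.decide.to_comp.comp hf hg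

theorem boolAnd {f g : α → Bool} (hf : Computable f) (hg : Computable g) :
    Computable fun a => f a && g a :=
  Primrec.and.to_comp.comp hf hg

theorem boolOr {f g : α → Bool} (hf : Computable f) (hg : Computable g) :
    Computable fun a => f a || g a :=
  Primrec.or.to_comp.comp hf hg

theorem boolNot {f : α → Bool} (hf : Computable f) : Computable fun a => !f a :=
  Primrec.not.to_comp.comp hf

theorem listTake {f : α → ℕ} {g : α → List σ} (hf : Computable f) (hg : Computable g) :
    Computable fun a => (g a).take (f a) :=
  Primrec.list_take.to_comp.comp hf hg

theorem sumRange {n : α → ℕ} {f : α → ℕ → ℕ} (hn : Computable n)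
    (hf : Computable fun p : α × ℕ => f p.1 p.2) :
    Computable fun a => ∑ j ∈ Finset.range (n a), f a j := by
  have h : Computable₂ fun (a : α) (p : ℕ × ℕ) => p.2 + f a p.1 :=
    (snd.comp snd).natAdd (hf.comp (fst.pair (fst.comp snd)))
  refine (Computable.nat_rec hn (const 0) h).of_eq fun a => ?_
  induction n a with
  | zero => rfl
  | succ k ih => rw [Finset.sum_range_succ, ← ih]

theorem decideExistsLT {n : α → ℕ} {p : α → ℕ → Bool} (hn : Computable n)
    (hp : Computable fun q : α × ℕ => p q.1 q.2) :
    Computable fun a => decide (∃ j < n a, p a j = true) := by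
  have h := decideLE (const 1)
    (sumRange hn (f := fun a j => bif p a j then 1 else 0) (hp.cond (const 1) (const 0)))
  refine h.of_eq fun a => ?_
  rw [decide_eq_decide, Nat.one_le_iff_ne_zero, Ne, Finset.sum_eq_zero_iff]
  simp only [Finset.mem_range, not_forall, exists_prop]
  refine exists_congr fun j => and_congr_right fun _ => ?_
  cases p a j <;> simp

end Computable

/-- Unbounded search that always succeeds is computable. -/
theorem Computable₂.exists_search {α : Type*} [Primcodable α] {p : α → ℕ → Bool}
    (hp : Computable₂ p) (h : ∀ a, ∃ n, p a n = true) :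
    ∃ f : α → ℕ, Computable f ∧ ∀ a, p a (f a) = true := by
  choose f hf using fun a => Nat.rfind_min' (h a).choose_spec
  have hr : Partrec fun a => Nat.rfind fun n => Part.some (p a n) :=
    Partrec.rfind (Computable.partrec hp)
  exact ⟨f, hr.of_eq_tot fun a => (hf a).1, fun a =>
    (Part.mem_some_iff.1 (Nat.rfind_spec (hf a).1)).symm⟩

theorem REPred.of_exists {α : Type*} [Primcodable α] {p : α → ℕ → Bool}
    (hp : Computable fun q : α × ℕ => p q.1 q.2) : REPred fun a => ∃ k, p a k = true := by
  have h : Partrec fun a => Nat.rfind fun k => Part.some (p a k) :=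
    Partrec.rfind (Computable.partrec hp)
  refine h.dom_re.of_eq fun a => Nat.rfind_dom.trans ⟨?_, ?_⟩
  · rintro ⟨n, hn, -⟩
    exact ⟨n, (Part.mem_some_iff.1 hn).symm⟩
  · rintro ⟨n, hn⟩
    exact ⟨n, Part.mem_some_iff.2 hn.symm, fun _ => trivial⟩

/-- Every recursively enumerable predicate is enumerated by a code in the sense of
`Nat.Partrec.Code.evaln`. -/
theorem REPred.exists_code {α : Type*} [Primcodable α] {p : α → Prop} (hp : REPred p) :
    ∃ c : Nat.Partrec.Code, ∀ a, p a ↔ ∃ k, (c.evaln k (Encodable.encode a)).isSome := by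
  obtain ⟨c, hc⟩ := Nat.Partrec.Code.exists_code.1 hp
  refine ⟨c, fun a => ?_⟩
  have h1 : p a ↔ (c.eval (Encodable.encode a)).Dom := by
    rw [hc]
    simp [Part.bind, Part.assert]
  rw [h1, Part.dom_iff_mem]
  simp only [Nat.Partrec.Code.evaln_complete, Option.isSome_iff_exists, Option.mem_def]
  exact exists_comm

namespace ImageRandomness

/-! ### Initial segments -/

/-- The string of the first `n` bits of `ω`. -/
def initSeg (ω : Cantor) (n : ℕ) : List Bool :=
  List.ofFn fun i : Fin n => ω i

@[simp] theorem length_initSeg (ω : Cantor) (n : ℕ) : (initSeg ω n).length = n := by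
  simp [initSeg]

@[simp] theorem getElem_initSeg (ω : Cantor) (n k : ℕ) (h : k < (initSeg ω n).length) :
    (initSeg ω n)[k] = ω k := by
  simp [initSeg]

theorem getElem?_initSeg (ω : Cantor) {n k : ℕ} (h : k < n) : (initSeg ω n)[k]? = some (ω k) := by
  simp [initSeg, h]

theorem take_initSeg (ω : Cantor) {k n : ℕ} (h : k ≤ n) : (initSeg ω n).take k = initSeg ω k :=
  List.ext_getElem (by simp [h]) fun i h1 h2 => by simp

theorem initSeg_prefix (ω : Cantor) {k n : ℕ} (h : k ≤ n) : initSeg ω k <+: initSeg ω n :=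
  take_initSeg ω h ▸ List.take_prefix _ _

theorem mem_cyl_iff {ω : Cantor} {x : List Bool} : ω ∈ cyl x ↔ initSeg ω x.length = x := by
  refine ⟨fun h => List.ext_getElem (by simp) fun i h1 h2 => by simp [h i h2], fun h k hk => ?_⟩
  have := getElem_initSeg ω x.length k (by simpa using hk)
  simp only [h] at this
  exact this.symm

theorem mem_cyl_initSeg (ω : Cantor) (n : ℕ) : ω ∈ cyl (initSeg ω n) :=
  fun k hk => by simp

theorem cyl_anti {x y : List Bool} (h : x <+: y) : cyl y ⊆ cyl x :=
  fun ω hω k hk => by rw [hω k (hk.trans_le h.length_le), h.getElem hk]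

theorem prefix_of_mem_cyl {ω : Cantor} {x y : List Bool} (hx : ω ∈ cyl x) (hy : ω ∈ cyl y)
    (h : x.length ≤ y.length) : x <+: y := by
  rw [← mem_cyl_iff.1 hx, ← mem_cyl_iff.1 hy]
  exact initSeg_prefix ω h

/-- A property of the first `s` bits defines a clopen set. -/
theorem isClopen_initSeg (s : ℕ) (p : List Bool → Prop) : IsClopen {ω | p (initSeg ω s)} := by
  have hc : Continuous fun (ω : Cantor) (i : Fin s) => ω i := by fun_prop
  exact (isClopen_discrete {v : Fin s → Bool | p (List.ofFn v)}).preimage hc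

theorem measurableSet_initSeg (s : ℕ) (p : List Bool → Prop) :
    MeasurableSet {ω | p (initSeg ω s)} :=
  (isClopen_initSeg s p).isOpen.measurableSet

theorem cyl_eq (x : List Bool) : cyl x = {ω | initSeg ω x.length = x} :=
  Set.ext fun _ => mem_cyl_iff

theorem measurableSet_cyl (x : List Bool) : MeasurableSet (cyl x) :=
  cyl_eq x ▸ measurableSet_initSeg x.length (· = x)

theorem isOpen_cyl (x : List Bool) : IsOpen (cyl x) :=
  cyl_eq x ▸ (isClopen_initSeg x.length (· = x)).isOpen

/-- For `j < 2 ^ s` these are all strings of length `s`, each of them once. -/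
def bitString (s j : ℕ) : List Bool :=
  (List.range s).map fun i => j.testBit i

@[simp] theorem length_bitString (s j : ℕ) : (bitString s j).length = s := by
  simp [bitString]

theorem bitString_computable : Computable₂ bitString := by
  have htest : Primrec₂ fun (p : ℕ × ℕ) (i : ℕ) => p.2.testBit i := by
    have hpow : Primrec fun q : (ℕ × ℕ) × ℕ => 2 ^ q.2 :=
      (Primrec₂.unpaired'.1 Nat.Primrec.pow).comp (Primrec.const 2) Primrec.snd
    have h := Primrec.eq.decide.comp
      (Primrec.nat_mod.comp (Primrec.nat_div.comp (Primrec.snd.comp Primrec.fst) hpow)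
        (Primrec.const 2)) (Primrec.const 1)
    exact h.of_eq fun q => Nat.testBit_eq_decide_div_mod_eq.symm
  exact (Primrec.list_map (Primrec.list_range.comp Primrec.fst) htest).to_comp

theorem exists_bitString (ω : Cantor) (s : ℕ) : ∃ j < 2 ^ s, bitString s j = initSeg ω s := by
  refine ⟨Nat.ofBits fun i : Fin s => ω i, Nat.ofBits_lt_two_pow _,
    List.ext_getElem (by simp) fun i h1 h2 => ?_⟩
  have hi : i < s := by simpa using h1
  simp [bitString, Nat.testBit_ofBits_lt _ i hi]

theorem bitString_injOn {s j k : ℕ} (hj : j < 2 ^ s) (hk : k < 2 ^ s)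
    (h : bitString s j = bitString s k) : j = k := by
  refine Nat.eq_of_testBit_eq fun i => ?_
  rcases lt_or_ge i s with hi | hi
  · have := congrArg (fun l => l[i]?) h
    simpa [bitString, hi] using this
  · rw [Nat.testBit_lt_two_pow (hj.trans_le (Nat.pow_le_pow_right two_pos hi)),
      Nat.testBit_lt_two_pow (hk.trans_le (Nat.pow_le_pow_right two_pos hi))]

theorem exists_mem_cyl (x : List Bool) : ∃ ω, ω ∈ cyl x :=
  ⟨fun k => x.getD k false, fun k hk => by simp [hk]⟩

end ImageRandomness

namespace ImageRandomness

/-! ### Running a machine on a finite portion of the tape -/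

/-- One step of `M` when only the part `y` of the input tape is known; the machine waits if the
next cell it needs lies beyond `y`.  A state consists of a configuration and the output so far. -/
def Machine.step (M : Machine) (y : List Bool) (c : ℕ × List Bool) : ℕ × List Bool :=
  match y[M.pos c.1]? with
  | none => c
  | some b => (M.next c.1 b, c.2 ++ (M.emit c.1 b).toList)

/-- The state after `t` steps on number `i` and the part `y` of the input tape. -/
def Machine.run (M : Machine) (i : ℕ) (y : List Bool) : ℕ → ℕ × List Bool
  | 0 => (M.init i, [])
  | t + 1 => M.step y (M.run i y t)

/-- What `M` prints within `y.length` steps on number `i` and the part `y` of the input tape. -/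
def Machine.sim (M : Machine) (i : ℕ) (y : List Bool) : List Bool :=
  (M.run i y y.length).2

namespace Machine

variable (M : Machine)

theorem step_computable : Computable₂ M.step := by
  have hpos : Computable fun q : List Bool × (ℕ × List Bool) => M.pos q.2.1 :=
    M.pos_computable.comp (Computable.fst.comp .snd)
  have ho : Computable fun q : List Bool × (ℕ × List Bool) => q.1[M.pos q.2.1]? :=
    Computable.list_getElem?.comp .fst hpos
  have hc : Computable fun r : (List Bool × (ℕ × List Bool)) × Bool => r.1.2.1 :=
    Computable.fst.comp (Computable.snd.comp .fst)
  have hl : Computable fun r : (List Bool × (ℕ × List Bool)) × Bool => r.1.2.2 :=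
    Computable.snd.comp (Computable.snd.comp .fst)
  have he : Computable fun r : (List Bool × (ℕ × List Bool)) × Bool =>
      (M.emit r.1.2.1 r.2).toList :=
    Primrec.optionToList.to_comp.comp (M.emit_computable.comp hc .snd)
  have hs : Computable fun r : (List Bool × (ℕ × List Bool)) × Bool =>
      (M.next r.1.2.1 r.2, r.1.2.2 ++ (M.emit r.1.2.1 r.2).toList) :=
    (M.next_computable.comp hc .snd).pair (Computable.list_append.comp hl he)
  refine (Computable.option_casesOn ho .snd hs.to₂).of_eq fun q => ?_
  rw [step]
  cases q.1[M.pos q.2.1]? <;> rfl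

theorem run_computable :
    Computable fun p : (ℕ × List Bool) × ℕ => M.run p.1.1 p.1.2 p.2 := by
  have hrec : Computable fun r : ((ℕ × List Bool) × ℕ) × (ℕ × (ℕ × List Bool)) =>
      M.step r.1.1.2 r.2.2 :=
    M.step_computable.comp (Computable.snd.comp (Computable.fst.comp .fst))
      (Computable.snd.comp .snd)
  have hinit : Computable fun p : (ℕ × List Bool) × ℕ => (M.init p.1.1, ([] : List Bool)) :=
    (M.init_computable.comp (Computable.fst.comp .fst)).pair (Computable.const [])
  have h := Computable.nat_rec (f := fun p : (ℕ × List Bool) × ℕ => p.2)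
    (h := fun p r => M.step p.1.2 r.2) Computable.snd hinit hrec
  refine h.of_eq ?_
  rintro ⟨⟨i, y⟩, t⟩
  induction t with
  | zero => rfl
  | succ t ih => exact congrArg (M.step y) ih

theorem sim_computable : Computable₂ M.sim := by
  have h : Computable fun p : ℕ × List Bool => (p, p.2.length) :=
    Computable.id.pair (Computable.list_length.comp .snd)
  have h' := M.run_computable.comp h
  exact Computable.snd.comp h'

theorem run_prefix_of_le (i : ℕ) (y : List Bool) {t t' : ℕ} (h : t ≤ t') :
    (M.run i y t).2 <+: (M.run i y t').2 := by
  induction h with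
  | refl => exact List.prefix_rfl
  | step _ ih =>
    refine ih.trans ?_
    rw [run, step]
    split
    · exact List.prefix_rfl
    · exact List.prefix_append _ _

theorem exists_run_eq_of_prefix (i : ℕ) {y y' : List Bool} (h : y <+: y') (t : ℕ) :
    ∃ u ≤ t, M.run i y t = M.run i y' u := by
  induction t with
  | zero => exact ⟨0, le_rfl, rfl⟩
  | succ t ih =>
    obtain ⟨u, hu, e⟩ := ih
    rw [run, e]
    cases hc : y[M.pos (M.run i y' u).1]? with
    | none => exact ⟨u, by omega, by simp [step, hc]⟩
    | some b =>
      refine ⟨u + 1, by omega, ?_⟩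
      have hc' : y'[M.pos (M.run i y' u).1]? = some b := by
        obtain ⟨z, rfl⟩ := h
        rwa [List.getElem?_append_left (List.getElem?_eq_some_iff.1 hc).1]
      simp only [run, step, hc, hc']

theorem sim_mono (i : ℕ) {y y' : List Bool} (h : y <+: y') : M.sim i y <+: M.sim i y' := by
  obtain ⟨u, hu, e⟩ := M.exists_run_eq_of_prefix i h y.length
  rw [sim, e]
  exact M.run_prefix_of_le i y' (hu.trans h.length_le)

theorem exists_run_initSeg (i : ℕ) (ω : Cantor) (n t : ℕ) :
    ∃ u ≤ t, M.run i (initSeg ω n) t = (M.config i ω u, M.output i ω u) := by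
  induction t with
  | zero => exact ⟨0, le_rfl, rfl⟩
  | succ t ih =>
    obtain ⟨u, hu, e⟩ := ih
    rw [run, e]
    rcases lt_or_ge (M.pos (M.config i ω u)) n with hn | hn
    · exact ⟨u + 1, by omega, by simp [step, getElem?_initSeg ω hn, config, output]⟩
    · exact ⟨u, by omega, by simp [step, hn]⟩

theorem eventually_run_initSeg (i : ℕ) (ω : Cantor) (t : ℕ) :
    ∃ N, ∀ n ≥ N, M.run i (initSeg ω n) t = (M.config i ω t, M.output i ω t) := by
  induction t with
  | zero => exact ⟨0, fun _ _ => rfl⟩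
  | succ t ih =>
    obtain ⟨N, hN⟩ := ih
    refine ⟨max N (M.pos (M.config i ω t) + 1), fun n hn => ?_⟩
    rw [run, hN n (le_of_max_le_left hn)]
    have hp : M.pos (M.config i ω t) < n := le_of_max_le_right hn
    simp [step, getElem?_initSeg ω hp, config, output]

variable {M} {i : ℕ} {ω β : Cantor}

theorem Computes.mem_cyl_sim (h : M.Computes i ω β) (n : ℕ) : β ∈ cyl (M.sim i (initSeg ω n)) := by
  obtain ⟨u, -, e⟩ := M.exists_run_initSeg i ω n (initSeg ω n).length
  rw [sim, e]
  exact h.1 u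

theorem Computes.exists_le_length_sim (h : M.Computes i ω β) (m : ℕ) :
    ∃ n, m ≤ (M.sim i (initSeg ω n)).length := by
  obtain ⟨t, ht⟩ := h.2 m
  obtain ⟨N, hN⟩ := M.eventually_run_initSeg i ω t
  refine ⟨max N t, ht.trans ?_⟩
  have h1 := M.run_prefix_of_le i (initSeg ω (max N t)) (t := t)
    (t' := (initSeg ω (max N t)).length) (by simp)
  rw [hN _ (le_max_left _ _)] at h1
  exact h1.length_le

theorem Computes.initSeg_prefix_sim (h : M.Computes i ω β) (m : ℕ) :
    ∃ n, initSeg β m <+: M.sim i (initSeg ω n) := by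
  obtain ⟨n, hn⟩ := h.exists_le_length_sim m
  exact ⟨n, prefix_of_mem_cyl (mem_cyl_initSeg β m) (h.mem_cyl_sim n) (by simpa using hn)⟩

end Machine

end ImageRandomness

namespace ImageRandomness

/-! ### Approximating the measure of clopen sets -/

theorem abs_div_sub_natDiv_le (a : ℕ) {b : ℕ} (hb : 0 < b) :
    |(a : ℝ) / b - ((a / b : ℕ) : ℝ)| ≤ 1 := by
  have hb' : (0 : ℝ) < b := by exact_mod_cast hb
  have h1 : ((a / b : ℕ) : ℝ) ≤ (a : ℝ) / b := Nat.cast_div_le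
  have h2 : (a : ℝ) / b < ((a / b : ℕ) : ℝ) + 1 := by
    rw [div_lt_iff₀ hb']
    exact_mod_cast (Nat.div_lt_iff_lt_mul hb).1 (Nat.lt_succ_self (a / b))
  rw [abs_le]
  constructor <;> linarith

theorem IsComputableDistribution.exists_dyadic {P : Measure Cantor}
    (hP : IsComputableDistribution P) :
    ∃ A : List Bool → ℕ → ℕ, Computable₂ A ∧
      ∀ x k, |P.real (cyl x) * 2 ^ k - A x k| ≤ 2 := by
  obtain ⟨f, hf, hfP⟩ := hP
  have hpow : Computable fun q : List Bool × ℕ => 2 ^ q.2 := Computable.twoPow .snd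
  have harg : Computable fun q : List Bool × ℕ => (q.1, 0, 2 ^ q.2 - 1) :=
    Computable.fst.pair ((Computable.const 0).pair (hpow.natSub (.const 1)))
  have hval := hf.comp harg
  refine ⟨fun x k => (f (x, 0, 2 ^ k - 1)).1 * 2 ^ k / ((f (x, 0, 2 ^ k - 1)).2 + 1),
    ((Computable.fst.comp hval).natMul hpow).natDiv
      ((Computable.snd.comp hval).natAdd (.const 1)), fun x k => ?_⟩
  have h := hfP x 0 (2 ^ k - 1)
  set c := (f (x, 0, 2 ^ k - 1)).1
  set d := (f (x, 0, 2 ^ k - 1)).2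
  have hk : (0 : ℝ) < 2 ^ k := by positivity
  have hcast : ((2 ^ k - 1 : ℕ) : ℝ) + 1 = 2 ^ k := by
    rw [Nat.cast_sub Nat.one_le_two_pow]
    push_cast
    ring
  rw [hcast, Nat.cast_zero, zero_add, le_div_iff₀ hk, ← abs_of_pos hk, ← abs_mul,
    sub_mul] at h
  have h2 := abs_div_sub_natDiv_le (c * 2 ^ k) (Nat.succ_pos d)
  push_cast at h2
  have h3 : (c : ℝ) / (d + 1) * 2 ^ k = c * 2 ^ k / (d + 1) := by ring
  rw [h3] at h
  rw [abs_le] at h h2 ⊢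
  constructor <;> push_cast <;> linarith [h.1, h.2, h2.1, h2.2]

theorem measureReal_initSeg (P : Measure Cantor) [IsFiniteMeasure P] (p : List Bool → Bool)
    (s : ℕ) :
    P.real {ω | p (initSeg ω s) = true} =
      ∑ j ∈ Finset.range (2 ^ s), bif p (bitString s j) then P.real (cyl (bitString s j)) else 0 := by
  have hset : {ω | p (initSeg ω s) = true} =
      ⋃ j ∈ (Finset.range (2 ^ s)).filter fun j => p (bitString s j) = true,
        cyl (bitString s j) := by
    ext ω
    simp only [Set.mem_ofPred_eq, Finset.mem_filter, Finset.mem_range, Set.mem_iUnion,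
      exists_prop, mem_cyl_iff, length_bitString]
    constructor
    · intro h
      obtain ⟨j, hj, e⟩ := exists_bitString ω s
      exact ⟨j, ⟨hj, e ▸ h⟩, e.symm⟩
    · rintro ⟨j, ⟨-, h⟩, e⟩
      rwa [e]
  rw [hset, measureReal_biUnion_finset, Finset.sum_filter]
  · exact Finset.sum_congr rfl fun j _ => by cases p (bitString s j) <;> simp
  · intro j hj k hk hjk
    refine Set.disjoint_left.2 fun ω h1 h2 => hjk ?_
    rw [mem_cyl_iff, length_bitString] at h1 h2
    simp only [Finset.coe_filter, Finset.mem_range, Set.mem_ofPred_eq] at hj hk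
    exact bitString_injOn hj.1 hk.1 (h1.symm.trans h2)
  · exact fun j _ => measurableSet_cyl _

/-- The probability of a decidable event that depends on the first `s` bits is computable,
uniformly in the event. -/
theorem IsComputableDistribution.exists_approx {α : Type*} [Primcodable α] {P : Measure Cantor}
    [IsFiniteMeasure P] (hP : IsComputableDistribution P) {p : α → List Bool → Bool}
    (hp : Computable₂ p) :
    ∃ A : α → ℕ → ℕ → ℕ, (Computable fun q : α × ℕ × ℕ => A q.1 q.2.1 q.2.2) ∧
      ∀ a s k, |P.real {ω | p a (initSeg ω s) = true} * 2 ^ k - A a s k| ≤ 2 := by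
  obtain ⟨A, hA, hAP⟩ := hP.exists_dyadic
  -- The `2 ^ s` summands are taken with `s + 1` extra bits, so that their errors add up to `1`.
  refine ⟨fun a s k => (∑ j ∈ Finset.range (2 ^ s),
    bif p a (bitString s j) then A (bitString s j) (k + (s + 1)) else 0) / 2 ^ (s + 1), ?_, ?_⟩
  · have hs : Computable fun q : α × ℕ × ℕ => q.2.1 := Computable.fst.comp .snd
    have hk : Computable fun q : α × ℕ × ℕ => q.2.2 := Computable.snd.comp .snd
    have hx : Computable fun r : (α × ℕ × ℕ) × ℕ => bitString r.1.2.1 r.2 :=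
      bitString_computable.comp (hs.comp .fst) .snd
    have hpx : Computable fun r : (α × ℕ × ℕ) × ℕ => p r.1.1 (bitString r.1.2.1 r.2) :=
      Computable₂.comp hp (Computable.fst.comp .fst) hx
    have hAx : Computable fun r : (α × ℕ × ℕ) × ℕ =>
        A (bitString r.1.2.1 r.2) (r.1.2.2 + (r.1.2.1 + 1)) :=
      hA.comp hx ((hk.comp .fst).natAdd ((hs.comp .fst).natAdd (.const 1)))
    have hf : Computable fun r : (α × ℕ × ℕ) × ℕ => bif p r.1.1 (bitString r.1.2.1 r.2) then
        A (bitString r.1.2.1 r.2) (r.1.2.2 + (r.1.2.1 + 1)) else 0 :=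
      Computable.cond hpx hAx (.const 0)
    have hsum := Computable.sumRange (f := fun (q : α × ℕ × ℕ) (j : ℕ) =>
      bif p q.1 (bitString q.2.1 j) then A (bitString q.2.1 j) (q.2.2 + (q.2.1 + 1)) else 0)
      (Computable.twoPow hs) hf
    exact hsum.natDiv (Computable.twoPow (hs.natAdd (.const 1)))
  · intro a s k
    set S := ∑ j ∈ Finset.range (2 ^ s),
      bif p a (bitString s j) then A (bitString s j) (k + (s + 1)) else 0 with hS
    have h1 : |P.real {ω | p a (initSeg ω s) = true} * 2 ^ (k + (s + 1)) - S| ≤ 2 ^ (s + 1) := by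
      rw [measureReal_initSeg, hS, Nat.cast_sum, Finset.sum_mul, ← Finset.sum_sub_distrib]
      refine (Finset.abs_sum_le_sum_abs _ _).trans ?_
      refine (Finset.sum_le_sum (g := fun _ => (2 : ℝ)) fun j _ => ?_).trans ?_
      · cases p a (bitString s j)
        · simp
        · exact hAP _ _
      · simp [pow_succ]
    have hpos : (0 : ℝ) < 2 ^ (s + 1) := by positivity
    have h2 := abs_div_sub_natDiv_le S (b := 2 ^ (s + 1)) (by positivity)
    have h3 : |P.real {ω | p a (initSeg ω s) = true} * 2 ^ k - S / 2 ^ (s + 1)| ≤ 1 := by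
      rw [← mul_le_mul_iff_left₀ hpos, ← abs_of_pos hpos, ← abs_mul, abs_of_pos hpos, sub_mul,
        div_mul_cancel₀ _ hpos.ne', one_mul, mul_assoc, ← pow_add]
      exact h1
    push_cast at h2
    rw [abs_le] at h2 h3 ⊢
    constructor <;> linarith [h2.1, h2.2, h3.1, h3.2]

/-! ### Effectively open sets -/

/-- Within `y.length` steps the code `c` accepts a pair `(n, x)` for some prefix `x` of `y`. -/
def codeAccepts (c : Nat.Partrec.Code) (n : ℕ) (y : List Bool) : Bool :=
  decide (∃ j < y.length + 1,
    (c.evaln y.length (Encodable.encode (n, y.take j))).isSome = true)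

theorem codeAccepts_computable :
    Computable₂ fun (a : Nat.Partrec.Code × ℕ) (x : List Bool) => codeAccepts a.1 a.2 x := by
  have hl : Computable fun q : (Nat.Partrec.Code × ℕ) × List Bool => q.2.length :=
    Computable.list_length.comp .snd
  have hc : Computable fun r : ((Nat.Partrec.Code × ℕ) × List Bool) × ℕ => r.1.1.1 :=
    Computable.fst.comp (Computable.fst.comp .fst)
  have hn : Computable fun r : ((Nat.Partrec.Code × ℕ) × List Bool) × ℕ => r.1.1.2 :=
    Computable.snd.comp (Computable.fst.comp .fst)
  have hx : Computable fun r : ((Nat.Partrec.Code × ℕ) × List Bool) × ℕ => r.1.2.take r.2 :=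
    Computable.listTake .snd (Computable.snd.comp .fst)
  have he : Computable fun r : ((Nat.Partrec.Code × ℕ) × List Bool) × ℕ =>
      Encodable.encode (r.1.1.2, r.1.2.take r.2) :=
    Computable.encode.comp (hn.pair hx)
  have hev := Nat.Partrec.Code.primrec_evaln.to_comp.comp (((hl.comp .fst).pair hc).pair he)
  exact Computable.decideExistsLT
    (p := fun (q : (Nat.Partrec.Code × ℕ) × List Bool) j =>
      (q.1.1.evaln q.2.length (Encodable.encode (q.1.2, q.2.take j))).isSome)
    (hl.natAdd (.const 1)) (Primrec.option_isSome.to_comp.comp hev)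

theorem codeAccepts_mono {c : Nat.Partrec.Code} {n : ℕ} {x y : List Bool} (h : x <+: y)
    (hx : codeAccepts c n x = true) : codeAccepts c n y = true := by
  simp only [codeAccepts, decide_eq_true_eq] at hx ⊢
  obtain ⟨j, hj, hs⟩ := hx
  refine ⟨j, hj.trans_le (Nat.succ_le_succ h.length_le), ?_⟩
  obtain ⟨z, rfl⟩ := h
  rw [List.take_append_of_le_length (by omega)]
  obtain ⟨v, hv⟩ := Option.isSome_iff_exists.1 hs
  exact Option.isSome_iff_exists.2 ⟨v, Nat.Partrec.Code.evaln_mono (by simp) hv⟩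

theorem UniformlyEffectivelyOpen.exists_code {U : ℕ → Set Cantor}
    (hU : UniformlyEffectivelyOpen U) :
    ∃ c, ∀ n, U n = {ω | ∃ m, codeAccepts c n (initSeg ω m) = true} := by
  obtain ⟨W, hW, hUW⟩ := hU
  obtain ⟨c, hc⟩ := hW.exists_code
  refine ⟨c, fun n => ?_⟩
  ext ω
  simp only [hUW, Set.mem_iUnion, exists_prop, Set.mem_ofPred_eq, codeAccepts, decide_eq_true_eq,
    length_initSeg, hc]
  constructor
  · rintro ⟨x, ⟨k, hk⟩, hx⟩
    refine ⟨max k x.length, x.length, Nat.lt_succ_of_le (le_max_right _ _), ?_⟩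
    rw [take_initSeg ω (le_max_right _ _), mem_cyl_iff.1 hx]
    obtain ⟨v, hv⟩ := Option.isSome_iff_exists.1 hk
    exact Option.isSome_iff_exists.2 ⟨v, Nat.Partrec.Code.evaln_mono (le_max_left _ _) hv⟩
  · rintro ⟨m, j, hj, h⟩
    refine ⟨_, ⟨m, h⟩, ?_⟩
    rw [take_initSeg ω (Nat.le_of_lt_succ hj)]
    exact mem_cyl_initSeg ω j

/-- Uniformly effectively open sets are given by a decidable property of finite strings that is
inherited by extensions. -/
theorem UniformlyEffectivelyOpen.exists_decidable {U : ℕ → Set Cantor}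
    (hU : UniformlyEffectivelyOpen U) :
    ∃ B : ℕ → List Bool → Bool, Computable₂ B ∧
      (∀ n x y, x <+: y → B n x = true → B n y = true) ∧
      ∀ n, U n = {ω | ∃ m, B n (initSeg ω m) = true} := by
  obtain ⟨c, hc⟩ := hU.exists_code
  have h := codeAccepts_computable.comp
    ((Computable.const c).pair (Computable.fst (α := ℕ) (β := List Bool))) .snd
  exact ⟨codeAccepts c, h, fun _ _ _ => codeAccepts_mono, hc⟩

theorem uniformlyEffectivelyOpen_of_computable {B : ℕ → List Bool → ℕ → Bool}
    (hB : Computable fun q : (ℕ × List Bool) × ℕ => B q.1.1 q.1.2 q.2) :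
    UniformlyEffectivelyOpen fun n => {ω | ∃ m j, B n (initSeg ω m) j = true} := by
  refine ⟨fun q : ℕ × List Bool => ∃ j, B q.1 q.2 j = true,
    REPred.of_exists (p := fun (q : ℕ × List Bool) j => B q.1 q.2 j) hB,
    fun n => ?_⟩
  ext ω
  simp only [Set.mem_ofPred_eq, Set.mem_iUnion, exists_prop]
  constructor
  · rintro ⟨m, j, h⟩
    exact ⟨_, ⟨j, h⟩, mem_cyl_initSeg ω m⟩
  · rintro ⟨x, ⟨j, h⟩, hx⟩
    exact ⟨x.length, j, by rwa [mem_cyl_iff.1 hx]⟩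

theorem UniformlyEffectivelyOpen.isOpen {U : ℕ → Set Cantor} (hU : UniformlyEffectivelyOpen U)
    (n : ℕ) : IsOpen (U n) := by
  obtain ⟨W, -, h⟩ := hU
  rw [h]
  exact isOpen_biUnion fun x _ => isOpen_cyl x

/-! ### Tails of tests and a universal test -/

theorem tsum_inv_two_pow_add_one : ∑' j : ℕ, (2⁻¹ : ℝ≥0∞) ^ (j + 1) = 1 := by
  rw [ENNReal.tsum_geometric_add_one, ENNReal.one_sub_inv_two, inv_inv,
    ENNReal.inv_mul_cancel two_ne_zero ENNReal.ofNat_ne_top]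

/-- A random sequence lies in only finitely many sets of a sequence that is a test up to a
constant factor and monotonicity: the unions of the tails form a test. -/
theorem IsMLRandom.eventually_notMem {P : Measure Cantor} {G : ℕ → Set Cantor}
    (hG : UniformlyEffectivelyOpen G) {C : ℕ} (hm : ∀ k, P (G k) ≤ 2 ^ C * 2⁻¹ ^ k) {ω : Cantor}
    (hω : IsMLRandom P ω) : ∃ N, ∀ k ≥ N, ω ∉ G k := by
  obtain ⟨B, hB, -, hGB⟩ := hG.exists_decidable
  -- The tail from `n + C + 1` on has measure at most `∑ j, 2 ^ C * 2⁻¹ ^ (n + C + j + 1) = 2⁻ⁿ`.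
  have hk : Computable fun q : (ℕ × List Bool) × ℕ => q.1.1 + (C + (q.2 + 1)) :=
    (Computable.fst.comp .fst).natAdd
      ((Computable.const C).natAdd (Computable.snd.natAdd (.const 1)))
  have hT : UniformlyEffectivelyOpen fun n => ⋃ j, G (n + (C + (j + 1))) := by
    have h := uniformlyEffectivelyOpen_of_computable
      (B := fun n x j => B (n + (C + (j + 1))) x) (hB.comp hk (Computable.snd.comp .fst))
    convert h using 2 with n
    ext ω
    simp only [hGB, Set.mem_iUnion, Set.mem_ofPred_eq]
    exact exists_comm
  have htest : IsMLTest P fun n => ⋃ j, G (n + (C + (j + 1))) := by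
    refine ⟨fun n n' hn => Set.iUnion_subset fun j => ?_, hT, fun n => ?_⟩
    · refine Set.subset_iUnion_of_subset (n' - n + j) (subset_of_eq ?_)
      congr 1
      omega
    · calc P (⋃ j, G (n + (C + (j + 1)))) ≤ ∑' j, P (G (n + (C + (j + 1)))) :=
            measure_iUnion_le _
        _ ≤ ∑' j : ℕ, 2⁻¹ ^ n * (2⁻¹ : ℝ≥0∞) ^ (j + 1) := by
            refine ENNReal.tsum_le_tsum fun j => (hm _).trans_eq ?_
            rw [pow_add, pow_add _ C, mul_left_comm, ← mul_assoc (2 ^ C), ← mul_pow,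
              ENNReal.mul_inv_cancel two_ne_zero ENNReal.ofNat_ne_top, one_pow, one_mul]
        _ = 2⁻¹ ^ n := by rw [ENNReal.tsum_mul_left, tsum_inv_two_pow_add_one, mul_one]
  obtain ⟨n, hn⟩ := hω _ htest
  refine ⟨n + (C + 1), fun k hk h => hn (Set.mem_iUnion.2 ⟨k - (n + (C + 1)), ?_⟩)⟩
  convert h using 2
  omega

/-- A universal test, up to a factor `2`.  For each code `c` and each level `n`, the union of the
sets enumerated by `c` at a stage is taken over those stages only at which its approximate measure
certifies a measure of at most `2 * 2⁻ⁿ`; this leaves every genuine test unchanged. -/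
theorem IsComputableDistribution.exists_universal {P : Measure Cantor} [IsFiniteMeasure P]
    (hP : IsComputableDistribution P) :
    ∃ G, UniformlyEffectivelyOpen G ∧ (∀ k, P (G k) ≤ 2 * 2⁻¹ ^ k) ∧
      ∀ ω, ¬ IsMLRandom P ω → ∀ k, ω ∈ G k := by
  obtain ⟨A, hA, hAP⟩ := hP.exists_approx codeAccepts_computable
  -- The `j`-th code contributes its trimmed level `n = k + j + 1`.  A set of measure at most `2⁻ⁿ`
  -- has an approximation of at most `2⁻ⁿ * 2 ^ (n + 2) + 2 = 6`, and conversely the bound `6`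
  -- on the approximation gives a measure of at most `(6 + 2) / 2 ^ (n + 2) = 2 * 2⁻ⁿ`.
  let B : ℕ → List Bool → ℕ → Bool := fun k x j =>
    codeAccepts (Denumerable.ofNat Nat.Partrec.Code j) (k + (j + 1)) x &&
      decide (A (Denumerable.ofNat Nat.Partrec.Code j, k + (j + 1)) x.length
        (k + (j + 1) + 2) ≤ 6)
  have hB : Computable fun q : (ℕ × List Bool) × ℕ => B q.1.1 q.1.2 q.2 := by
    have hn : Computable fun q : (ℕ × List Bool) × ℕ => q.1.1 + (q.2 + 1) :=
      (Computable.fst.comp .fst).natAdd (Computable.snd.natAdd (.const 1))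
    have hc : Computable fun q : (ℕ × List Bool) × ℕ =>
        (Denumerable.ofNat Nat.Partrec.Code q.2, q.1.1 + (q.2 + 1)) :=
      ((Computable.ofNat Nat.Partrec.Code).comp .snd).pair hn
    have hx : Computable fun q : (ℕ × List Bool) × ℕ => q.1.2 := Computable.snd.comp .fst
    have h1 := codeAccepts_computable.comp hc hx
    have h2 := hA.comp (hc.pair ((Computable.list_length.comp hx).pair (hn.natAdd (.const 2))))
    exact h1.boolAnd (h2.decideLE (.const 6))
  refine ⟨_, uniformlyEffectivelyOpen_of_computable hB, fun k => ?_, fun ω hω k => ?_⟩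
  · have hset : {ω | ∃ m j, B k (initSeg ω m) j = true} =
        ⋃ j, ⋃ m, {ω | B k (initSeg ω m) j = true} := by
      ext ω
      simp only [Set.mem_iUnion, Set.mem_ofPred_eq]
      exact exists_comm
    have hj : ∀ j, P (⋃ m, {ω | B k (initSeg ω m) j = true}) ≤
        2 * 2⁻¹ ^ k * 2⁻¹ ^ (j + 1) := by
      intro j
      set c := Denumerable.ofNat Nat.Partrec.Code j with hc
      have hBm : ∀ m, {ω | B k (initSeg ω m) j = true} =
          {ω | codeAccepts c (k + (j + 1)) (initSeg ω m) = true ∧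
            A (c, k + (j + 1)) m (k + (j + 1) + 2) ≤ 6} := by
        intro m
        ext ω
        simp [B, hc]
      -- A rejected stage contributes the empty set, so any two stages are comparable.
      have hdir : Directed (· ⊆ ·) fun m => {ω | B k (initSeg ω m) j = true} := by
        have key : ∀ m m', m ≤ m' → {ω | B k (initSeg ω m) j = true} ⊆
            {ω | B k (initSeg ω m') j = true} ∨ {ω | B k (initSeg ω m') j = true} ⊆
            {ω | B k (initSeg ω m) j = true} := by
          intro m m' h
          rw [hBm, hBm]
          by_cases hacc : A (c, k + (j + 1)) m' (k + (j + 1) + 2) ≤ 6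
          · exact Or.inl fun ω hω => ⟨codeAccepts_mono (initSeg_prefix ω h) hω.1, hacc⟩
          · exact Or.inr fun ω hω => absurd hω.2 hacc
        intro m m'
        rcases le_total m m' with h | h <;> rcases key _ _ h with h | h
        · exact ⟨m', h, subset_rfl⟩
        · exact ⟨m, subset_rfl, h⟩
        · exact ⟨m, subset_rfl, h⟩
        · exact ⟨m', h, subset_rfl⟩
      rw [hdir.measure_iUnion]
      refine iSup_le fun m => ?_
      rw [hBm]
      by_cases hacc : A (c, k + (j + 1)) m (k + (j + 1) + 2) ≤ 6
      · refine (measure_mono (t := {ω | codeAccepts c (k + (j + 1)) (initSeg ω m) = true})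
          fun ω hω => hω.1).trans ?_
        have h := (abs_le.1 (hAP (c, k + (j + 1)) m (k + (j + 1) + 2))).2
        have hacc' : (A (c, k + (j + 1)) m (k + (j + 1) + 2) : ℝ) ≤ 6 := by exact_mod_cast hacc
        have hle : P.real {ω | codeAccepts c (k + (j + 1)) (initSeg ω m) = true} ≤
            2 * 2⁻¹ ^ (k + (j + 1)) := by
          rw [inv_pow, ← div_eq_mul_inv, le_div_iff₀ (by positivity)]
          rw [pow_add _ _ 2] at h
          linarith
        rw [← ofReal_measureReal, mul_assoc, ← pow_add]
        refine (ENNReal.ofReal_le_ofReal hle).trans_eq ?_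
        rw [ENNReal.ofReal_mul zero_le_two, ENNReal.ofReal_pow (by positivity),
          ENNReal.ofReal_inv_of_pos two_pos, ENNReal.ofReal_ofNat]
      · simp [hacc]
    rw [hset]
    calc P (⋃ j, ⋃ m, {ω | B k (initSeg ω m) j = true})
        ≤ ∑' j : ℕ, 2 * 2⁻¹ ^ k * (2⁻¹ : ℝ≥0∞) ^ (j + 1) :=
          (measure_iUnion_le _).trans (ENNReal.tsum_le_tsum hj)
      _ = 2 * 2⁻¹ ^ k := by rw [ENNReal.tsum_mul_left, tsum_inv_two_pow_add_one, mul_one]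
  · simp only [IsMLRandom, not_forall, not_exists, not_not] at hω
    obtain ⟨U, hU, hωU⟩ := hω
    obtain ⟨c, hc⟩ := hU.effectivelyOpen.exists_code
    have hmem := hωU (k + (Encodable.encode c + 1))
    rw [hc] at hmem
    obtain ⟨m, hm⟩ := hmem
    refine ⟨m, Encodable.encode c, ?_⟩
    set n := k + (Encodable.encode c + 1) with hn
    have hle : P.real {ω | codeAccepts c n (initSeg ω m) = true} ≤ 2⁻¹ ^ n := by
      have h1 : P {ω | codeAccepts c n (initSeg ω m) = true} ≤ 2⁻¹ ^ n := by
        refine (measure_mono ?_).trans (hU.measure_le n)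
        rw [hc]
        exact fun ω h => ⟨m, h⟩
      have h2 := ENNReal.toReal_mono (by simp) h1
      simpa [Measure.real] using h2
    have h := (abs_le.1 (hAP (c, n) m (n + 2))).1
    have hmul : P.real {ω | codeAccepts c n (initSeg ω m) = true} * 2 ^ (n + 2) ≤ 4 := by
      rw [inv_pow, ← one_div, le_div_iff₀ (by positivity)] at hle
      rw [pow_add]
      linarith
    have hA6 : (A (c, n) m (n + 2) : ℝ) ≤ 6 := by linarith
    have hA6' : A (c, n) m (n + 2) ≤ 6 := by exact_mod_cast hA6
    simp only [B, Denumerable.ofNat_encode, ← hn, hm, length_initSeg, hA6', decide_true,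
      Bool.and_self]

theorem IsComputableDistribution.measurableSet_isMLRandom {P : Measure Cantor} [IsFiniteMeasure P]
    (hP : IsComputableDistribution P) : MeasurableSet {ω | IsMLRandom P ω} := by
  obtain ⟨G, hG, hm, hu⟩ := hP.exists_universal
  have h : {ω | IsMLRandom P ω} = ⋃ k, (G k)ᶜ := by
    ext ω
    simp only [Set.mem_ofPred_eq, Set.mem_iUnion, Set.mem_compl_iff]
    constructor
    · intro hω
      obtain ⟨N, hN⟩ := hω.eventually_notMem hG (C := 1) (by simpa using hm)
      exact ⟨N, hN N le_rfl⟩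
    · rintro ⟨k, hk⟩
      exact not_not.1 fun hω => hk (hu ω hω k)
  rw [h]
  exact MeasurableSet.iUnion fun k => (hG.isOpen k).measurableSet.compl

theorem IsComputableDistribution.ae_isMLRandom {P : Measure Cantor} [IsFiniteMeasure P]
    (hP : IsComputableDistribution P) : ∀ᵐ ω ∂P, IsMLRandom P ω := by
  obtain ⟨G, -, hm, hu⟩ := hP.exists_universal
  have hlim : Filter.Tendsto (fun k : ℕ => (2 : ℝ≥0∞) * 2⁻¹ ^ k) Filter.atTop (nhds 0) := by
    have h := ENNReal.Tendsto.const_mul (a := 2) (ENNReal.tendsto_pow_atTop_nhds_zero_of_lt_one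
      (r := 2⁻¹) (by simp)) (Or.inr ENNReal.ofNat_ne_top)
    simpa using h
  refine le_antisymm (ge_of_tendsto' hlim fun k => ?_) zero_le
  exact (measure_mono fun ω hω => hu ω hω k).trans (hm k)

end ImageRandomness

namespace ImageRandomness

/-! ### The image distribution -/

section LayerwiseComputable

variable {P : Measure Cantor} {F : {ω : Cantor // IsMLRandom P ω} → Cantor}
  {U : ℕ → Set Cantor} {M : Machine}

theorem IsLayerwiseComputable.measurable (hF : IsLayerwiseComputable P F) : Measurable F := by
  obtain ⟨U, M, hU, hM⟩ := hF
  refine measurable_pi_iff.2 fun m => measurable_to_bool ?_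
  have hset : (fun ω => F ω m) ⁻¹' {true} = Subtype.val ⁻¹'
      ⋃ i, (U i)ᶜ ∩ ⋃ s, {ω | (M.sim i (initSeg ω s))[m]? = some true} := by
    ext ω
    simp only [Set.mem_preimage, Set.mem_singleton_iff, Set.mem_iUnion, Set.mem_inter_iff,
      Set.mem_compl_iff, Set.mem_ofPred_eq]
    constructor
    · intro h
      obtain ⟨i, hi⟩ := ω.2 U hU
      obtain ⟨s, hs⟩ := (hM i ω hi).exists_le_length_sim (m + 1)
      exact ⟨i, hi, s, by rw [List.getElem?_eq_getElem hs, ← h, (hM i ω hi).mem_cyl_sim s m hs]⟩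
    · rintro ⟨i, hi, s, h⟩
      obtain ⟨hlt, e⟩ := List.getElem?_eq_some_iff.1 h
      rw [(hM i ω hi).mem_cyl_sim s m hlt, e]
  rw [hset]
  refine measurable_subtype_coe (MeasurableSet.iUnion fun i => ?_)
  exact (hU.effectivelyOpen.isOpen i).measurableSet.compl.inter
    (MeasurableSet.iUnion fun s => measurableSet_initSeg s fun x => (M.sim i x)[m]? = some true)

theorem preimageSet_eq_image (F : {ω : Cantor // IsMLRandom P ω} → Cantor) (X : Set Cantor) :
    preimageSet F X = Subtype.val '' (F ⁻¹' X) := by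
  ext ω
  simp [preimageSet]

theorem measurableSet_preimageSet [IsFiniteMeasure P] (hP : IsComputableDistribution P)
    (hF : Measurable F) {X : Set Cantor} (hX : MeasurableSet X) :
    MeasurableSet (preimageSet F X) :=
  preimageSet_eq_image F X ▸ hP.measurableSet_isMLRandom.subtype_image (hF hX)

theorem imageDistribution_apply [IsFiniteMeasure P] (hP : IsComputableDistribution P)
    (hF : Measurable F) {X : Set Cantor} (hX : MeasurableSet X) :
    imageDistribution P F X = P (preimageSet F X) := by
  rw [imageDistribution, Measure.map_apply hF hX, preimageSet_eq_image]
  exact (MeasurableEmbedding.subtype_coe hP.measurableSet_isMLRandom).comap_apply P _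

theorem isProbabilityMeasure_imageDistribution [IsProbabilityMeasure P]
    (hP : IsComputableDistribution P) (hF : Measurable F) :
    IsProbabilityMeasure (imageDistribution P F) := by
  constructor
  have hadd := prob_add_prob_compl (μ := P) (measurableSet_preimageSet hP hF MeasurableSet.univ)
  have h : (preimageSet F Set.univ)ᶜ = {ω | ¬ IsMLRandom P ω} := by
    ext ω
    simp [preimageSet]
  have h0 : P {ω | ¬ IsMLRandom P ω} = 0 := hP.ae_isMLRandom
  rwa [h, h0, add_zero, ← imageDistribution_apply hP hF MeasurableSet.univ] at hadd

theorem IsMLTest.measureReal_le [IsFiniteMeasure P] (hU : IsMLTest P U) (i : ℕ) :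
    P.real (U i) * 2 ^ i ≤ 1 := by
  have h := ENNReal.toReal_mono (by simp) (hU.measure_le i)
  rw [ENNReal.toReal_pow, ENNReal.toReal_inv, ENNReal.toReal_ofNat, inv_pow, ← one_div,
    le_div_iff₀ (by positivity)] at h
  exact h

/-! ### Computability of the image distribution -/

/-- Outside a set of measure at most `2⁻ⁱ` the machine prints `n` bits on number `i`, hence on a
set of measure almost `1 - 2⁻ⁱ` it does so within a bounded time. -/
theorem exists_le_measureReal_sim [IsProbabilityMeasure P] (hP : IsComputableDistribution P)
    (hU : IsMLTest P U)
    (hM : ∀ (i : ℕ) (ω : {ω : Cantor // IsMLRandom P ω}), ω.1 ∉ U i → M.Computes i ω.1 (F ω))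
    (i n : ℕ) :
    ∃ s, 2 ^ i - 2 ≤ P.real {ω | n ≤ (M.sim i (initSeg ω s)).length} * 2 ^ i := by
  have hpos : (0 : ℝ) < 2 ^ i := by positivity
  set S : ℕ → Set Cantor := fun s => {ω | n ≤ (M.sim i (initSeg ω s)).length} with hS
  have hmono : Monotone S := fun s s' h ω hω =>
    le_trans hω (M.sim_mono i (initSeg_prefix ω h)).length_le
  have hunion : (U i)ᶜ ≤ᵐ[P] ⋃ s, S s := by
    filter_upwards [hP.ae_isMLRandom] with ω hω hωU
    exact Set.mem_iUnion.2 ((hM i ⟨ω, hω⟩ hωU).exists_le_length_sim n)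
  have hge : 1 - P.real (U i) ≤ P.real (⋃ s, S s) := by
    rw [← probReal_compl_eq_one_sub (hU.effectivelyOpen.isOpen i).measurableSet]
    exact ENNReal.toReal_mono (measure_ne_top _ _) (measure_mono_ae hunion)
  have hlim : Filter.Tendsto (fun s => P.real (S s) * 2 ^ i) Filter.atTop
      (nhds (P.real (⋃ s, S s) * 2 ^ i)) :=
    ((ENNReal.tendsto_toReal (measure_ne_top _ _)).comp
      (tendsto_measure_iUnion_atTop hmono)).mul_const _
  have hlt : (2 : ℝ) ^ i - 2 < P.real (⋃ s, S s) * 2 ^ i := by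
    have h1 := mul_le_mul_of_nonneg_right hge hpos.le
    have h2 := hU.measureReal_le i
    linarith
  obtain ⟨s, hs⟩ := (hlim.eventually (lt_mem_nhds hlt)).exists
  exact ⟨s, hs.le⟩

theorem isComputableDistribution_imageDistribution [IsProbabilityMeasure P]
    (hP : IsComputableDistribution P) (hF : IsLayerwiseComputable P F) :
    IsComputableDistribution (imageDistribution P F) := by
  have hFm := hF.measurable
  obtain ⟨U, M, hU, hM⟩ := hF
  have hsim : Computable₂ fun (a : ℕ × List Bool) (y : List Bool) => M.sim a.1 y :=
    M.sim_computable.comp (Computable.fst.comp .fst) .snd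
  have hx : Computable fun q : (ℕ × List Bool) × List Bool => q.1.2 :=
    Computable.snd.comp .fst
  have hlen := Computable.list_length.comp hx
  have hp₁ : Computable₂ fun (a : ℕ × List Bool) (y : List Bool) =>
      decide (a.2.length ≤ (M.sim a.1 y).length) :=
    Computable.decideLE hlen (Computable.list_length.comp hsim)
  have hp₂ : Computable₂ fun (a : ℕ × List Bool) (y : List Bool) =>
      decide (a.2 = (M.sim a.1 y).take a.2.length) :=
    Computable.decideEq hx (Computable.listTake hlen hsim)
  obtain ⟨A₁, hA₁, hAP₁⟩ := hP.exists_approx hp₁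
  obtain ⟨A₂, hA₂, hAP₂⟩ := hP.exists_approx hp₂
  simp only [decide_eq_true_eq] at hAP₁ hAP₂
  -- Search for a time by which the machine has printed enough bits with high probability.
  have hsearch : Computable₂ fun (a : ℕ × List Bool) (s : ℕ) =>
      decide (2 ^ a.1 ≤ A₁ a s a.1 + 4) := by
    have hi : Computable fun q : (ℕ × List Bool) × ℕ => q.1.1 := Computable.fst.comp .fst
    have h := hA₁.comp (Computable.fst.pair (Computable.snd.pair hi))
    exact Computable.decideLE (Computable.twoPow hi) (h.natAdd (.const 4))
  obtain ⟨t, ht, htP⟩ := hsearch.exists_search fun a => by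
    obtain ⟨s, hs⟩ := exists_le_measureReal_sim hP hU hM a.1 a.2.length
    refine ⟨s, decide_eq_true ?_⟩
    have h := (abs_le.1 (hAP₁ a s a.1)).2
    have h' : (2 : ℝ) ^ a.1 ≤ A₁ a s a.1 + 4 := by linarith
    exact_mod_cast h'
  -- The total error is `9 * 2⁻ⁱ`, which is below `1 / (b + 1)` for `i = b + 4`.
  refine ⟨fun q => (A₂ (q.2.2 + 4, q.1) (t (q.2.2 + 4, q.1)) (q.2.2 + 4), 2 ^ (q.2.2 + 4) - 1),
    ?_, fun x a b => ?_⟩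
  · have hi : Computable fun q : List Bool × ℕ × ℕ => q.2.2 + 4 :=
      (Computable.snd.comp .snd).natAdd (.const 4)
    have ha := hi.pair (Computable.fst (α := List Bool) (β := ℕ × ℕ))
    have h := hA₂.comp (ha.pair ((ht.comp ha).pair hi))
    exact h.pair ((Computable.twoPow hi).natSub (.const 1))
  · set i := b + 4 with hi
    set s := t (i, x)
    set D : Set Cantor := {ω | x = (M.sim i (initSeg ω s)).take x.length} with hD
    set S : Set Cantor := {ω | x.length ≤ (M.sim i (initSeg ω s)).length} with hS
    have hpos : (0 : ℝ) < 2 ^ i := by positivity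
    have hQ : (imageDistribution P F).real (cyl x) = P.real (preimageSet F (cyl x)) :=
      congrArg ENNReal.toReal (imageDistribution_apply hP hFm (measurableSet_cyl x))
    have hS1 : P.real Sᶜ * 2 ^ i ≤ 6 := by
      have h1 : (2 : ℝ) ^ i ≤ A₁ (i, x) s i + 4 := by
        exact_mod_cast of_decide_eq_true (htP (i, x))
      have h2 := (abs_le.1 (hAP₁ (i, x) s i)).1
      have hSm : MeasurableSet S :=
        measurableSet_initSeg s fun y => x.length ≤ (M.sim i y).length
      rw [probReal_compl_eq_one_sub hSm, sub_mul]
      linarith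
    have hU1 := hU.measureReal_le i
    have hle : P.real (preimageSet F (cyl x)) ≤ P.real D + (P.real (U i) + P.real Sᶜ) := by
      have hsub : preimageSet F (cyl x) ⊆ D ∪ (U i ∪ Sᶜ) := by
        rintro ω ⟨hω, hFω⟩
        by_cases hωU : ω ∈ U i
        · exact Or.inr (Or.inl hωU)
        by_cases hωS : ω ∈ S
        · exact Or.inl (List.prefix_iff_eq_take.1
            (prefix_of_mem_cyl hFω ((hM i ⟨ω, hω⟩ hωU).mem_cyl_sim s) hωS))
        · exact Or.inr (Or.inr hωS)
      exact (measureReal_mono hsub).trans ((measureReal_union_le _ _).trans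
        (add_le_add_right (measureReal_union_le _ _) _))
    have hge : P.real D ≤ P.real (preimageSet F (cyl x)) + P.real (U i) := by
      have hsub : D ≤ᵐ[P] (preimageSet F (cyl x) ∪ U i : Set Cantor) := by
        filter_upwards [hP.ae_isMLRandom] with ω hω hωD
        by_cases hωU : ω ∈ U i
        · exact Or.inr hωU
        · exact Or.inl ⟨hω, cyl_anti (List.prefix_iff_eq_take.2 hωD)
            ((hM i ⟨ω, hω⟩ hωU).mem_cyl_sim s)⟩
      exact (ENNReal.toReal_mono (measure_ne_top _ _) (measure_mono_ae hsub)).trans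
        (measureReal_union_le _ _)
    have h2 := abs_le.1 (hAP₂ (i, x) s i)
    have hle' := mul_le_mul_of_nonneg_right hle hpos.le
    have hge' := mul_le_mul_of_nonneg_right hge hpos.le
    have hcast : ((2 ^ i - 1 : ℕ) : ℝ) + 1 = 2 ^ i := by
      rw [Nat.cast_sub Nat.one_le_two_pow]
      push_cast
      ring
    have hb : (b : ℝ) + 1 ≤ 2 ^ b := by exact_mod_cast Nat.lt_two_pow_self
    have h9 : |(imageDistribution P F).real (cyl x) - A₂ (i, x) s i / 2 ^ i| * 2 ^ i ≤ 9 := by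
      rw [← abs_of_pos hpos, ← abs_mul, abs_of_pos hpos, sub_mul, div_mul_cancel₀ _ hpos.ne', hQ,
        abs_le]
      have hU0 : 0 ≤ P.real (U i) * 2 ^ i := by positivity
      constructor <;> linarith [h2.1, h2.2]
    have hi16 : (2 : ℝ) ^ i = 2 ^ b * 16 := by
      rw [hi, pow_add]
      norm_num
    change |(imageDistribution P F).real (cyl x) - A₂ (i, x) s i / (((2 ^ i - 1 : ℕ) : ℝ) + 1)| ≤ _
    rw [hcast]
    calc _ ≤ 9 / (2 : ℝ) ^ i := (le_div_iff₀ hpos).2 h9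
      _ ≤ 1 / ((b : ℝ) + 1) := by
          rw [div_le_div_iff₀ hpos (by positivity), hi16]
          linarith
      _ ≤ ((a : ℝ) + 1) / ((b : ℝ) + 1) := by
          gcongr
          linarith [(Nat.cast_nonneg a : (0 : ℝ) ≤ a)]

/-! ### Images of random sequences are random -/

/-- A test for the image distribution is pulled back: the `k`-th set consists of the sequences on
which the machine, given the number `k`, prints a prefix that certifies membership in the `k`-th
set of the test.  For random sequences outside `U k` this is the preimage under `F`. -/
theorem isMLRandom_image [IsProbabilityMeasure P] (hP : IsComputableDistribution P)
    (hF : IsLayerwiseComputable P F) (α : {ω : Cantor // IsMLRandom P ω}) :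
    IsMLRandom (imageDistribution P F) (F α) := by
  have hFm := hF.measurable
  obtain ⟨U, M, hU, hM⟩ := hF
  intro V hV
  by_contra! hα
  obtain ⟨B, hB, hBmono, hVB⟩ := hV.effectivelyOpen.exists_decidable
  have hG : UniformlyEffectivelyOpen fun k =>
      {ω | ∃ m, ∃ _ : ℕ, B k (M.sim k (initSeg ω m)) = true} := by
    have hk : Computable fun q : (ℕ × List Bool) × ℕ => q.1.1 := Computable.fst.comp .fst
    have hsim := M.sim_computable.comp hk
      (Computable.snd.comp (Computable.fst (α := ℕ × List Bool) (β := ℕ)))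
    exact uniformlyEffectivelyOpen_of_computable
      (B := fun k y _ => B k (M.sim k y)) (hB.comp hk hsim)
  have hm : ∀ k, P {ω | ∃ m, ∃ _ : ℕ, B k (M.sim k (initSeg ω m)) = true} ≤ 2 ^ 1 * 2⁻¹ ^ k := by
    intro k
    have hsub : {ω | ∃ m, ∃ _ : ℕ, B k (M.sim k (initSeg ω m)) = true} ≤ᵐ[P]
        (preimageSet F (V k) ∪ U k : Set Cantor) := by
      filter_upwards [hP.ae_isMLRandom] with ω hω hωG
      obtain ⟨m, -, hmB⟩ := hωG
      by_cases hωU : ω ∈ U k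
      · exact Or.inr hωU
      · refine Or.inl ⟨hω, ?_⟩
        rw [hVB]
        refine ⟨(M.sim k (initSeg ω m)).length, ?_⟩
        rwa [mem_cyl_iff.1 ((hM k ⟨ω, hω⟩ hωU).mem_cyl_sim m)]
    calc _ ≤ P (preimageSet F (V k)) + P (U k) :=
          (measure_mono_ae hsub).trans (measure_union_le _ _)
      _ ≤ 2⁻¹ ^ k + 2⁻¹ ^ k := by
          refine add_le_add ?_ (hU.measure_le k)
          rw [← imageDistribution_apply hP hFm (hV.effectivelyOpen.isOpen k).measurableSet]
          exact hV.measure_le k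
      _ = 2 ^ 1 * 2⁻¹ ^ k := by rw [pow_one, two_mul]
  obtain ⟨N, hN⟩ := α.2.eventually_notMem hG hm
  obtain ⟨i, hi⟩ := α.2 U hU
  have hk : α.1 ∉ U (max N i) := fun h => hi (hU.antitone (le_max_right _ _) h)
  have hαV := hα (max N i)
  rw [hVB] at hαV
  obtain ⟨m, hmB⟩ := hαV
  obtain ⟨n, hn⟩ := (hM _ α hk).initSeg_prefix_sim m
  exact hN _ (le_max_left _ _) ⟨n, 0, hBmono _ _ _ hn hmB⟩

/-! ### Random sequences are images of random sequences -/

theorem UniformlyEffectivelyOpen.union {U V : ℕ → Set Cantor} (hU : UniformlyEffectivelyOpen U)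
    (hV : UniformlyEffectivelyOpen V) : UniformlyEffectivelyOpen fun n => U n ∪ V n := by
  obtain ⟨W₁, hW₁, h₁⟩ := hU.exists_decidable
  obtain ⟨W₂, hW₂, h₂⟩ := hV.exists_decidable
  have hk : Computable fun q : (ℕ × List Bool) × ℕ => q.1.1 := Computable.fst.comp .fst
  have hx : Computable fun q : (ℕ × List Bool) × ℕ => q.1.2 := Computable.snd.comp .fst
  have h := uniformlyEffectivelyOpen_of_computable (B := fun n x _ => W₁ n x || W₂ n x)
    ((hW₁.comp hk hx).boolOr (hW₂.comp hk hx))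
  convert h using 2 with n
  ext ω
  simp [h₁, h₂, exists_or]

/-- Two strings are consistent if one of them is a prefix of the other. -/
def consistent (x z : List Bool) : Bool :=
  decide (x.take z.length = z.take x.length)

theorem consistent_iff {x z : List Bool} : consistent x z = true ↔
    ∀ k (hx : k < x.length) (hz : k < z.length), x[k] = z[k] := by
  rw [consistent, decide_eq_true_eq]
  constructor
  · intro h k hx hz
    have := congrArg (·[k]?) h
    simpa [List.getElem?_take, hx, hz] using this
  · intro h
    refine List.ext_getElem (by simp [min_comm]) fun k h1 h2 => ?_
    simp only [List.length_take, lt_min_iff] at h1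
    simpa using h k h1.2 h1.1

theorem consistent_of_prefix {x x' z z' : List Bool} (hx : x <+: x') (hz : z <+: z')
    (h : consistent x' z' = true) : consistent x z = true := by
  rw [consistent_iff] at h ⊢
  intro k h1 h2
  rw [hx.getElem h1, hz.getElem h2]
  exact h k (h1.trans_le hx.length_le) (h2.trans_le hz.length_le)

theorem consistent_of_mem_cyl {β : Cantor} {x z : List Bool} (hx : β ∈ cyl x) (hz : β ∈ cyl z) :
    consistent x z = true :=
  consistent_iff.2 fun k h1 h2 => by rw [← hx k h1, ← hz k h2]

/-- Let `H i` be the union of the `i`-th sets of the given test and of a universal test.  The image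
under `F` of the compact complement of `H i` is effectively closed: by compactness, a cylinder is
disjoint from it as soon as, for some `s`, every string of length `s` either is seen to lie in `H i`
or makes the machine print something inconsistent with the cylinder.  The complements of these
images form a test for the image distribution, up to a constant factor. -/
theorem exists_isMLRandom_eq [IsProbabilityMeasure P] (hP : IsComputableDistribution P)
    (hF : IsLayerwiseComputable P F) {β : Cantor} (hβ : IsMLRandom (imageDistribution P F) β) :
    ∃ α, F α = β := by
  have hFm := hF.measurable
  obtain ⟨U, M, hU, hM⟩ := hF
  obtain ⟨G, hG, hGm, hGu⟩ := hP.exists_universal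
  obtain ⟨B, hB, hBmono, hHB⟩ := (hU.effectivelyOpen.union hG).exists_decidable
  let r : ℕ → List Bool → List Bool → Bool := fun i x y => B i y || !consistent x (M.sim i y)
  have hrmono : ∀ {i x x' y y'}, x <+: x' → y <+: y' → r i x' y' = false → r i x y = false := by
    intro i x x' y y' hx hy h
    simp only [r, Bool.or_eq_false_iff, Bool.not_eq_false'] at h ⊢
    refine ⟨?_, consistent_of_prefix hx (M.sim_mono i hy) h.2⟩
    by_contra hB
    exact absurd (hBmono i y y' hy (by simpa using hB)) (by simp [h.1])
  have hV : UniformlyEffectivelyOpen fun i => {β | ∃ m s,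
      (!decide (∃ j < 2 ^ s, (!r i (initSeg β m) (bitString s j)) = true)) = true} := by
    have hi : Computable fun q : ((ℕ × List Bool) × ℕ) × ℕ => q.1.1.1 :=
      Computable.fst.comp (Computable.fst.comp .fst)
    have hx : Computable fun q : ((ℕ × List Bool) × ℕ) × ℕ => q.1.1.2 :=
      Computable.snd.comp (Computable.fst.comp .fst)
    have hy := bitString_computable.comp
      (Computable.snd.comp (Computable.fst (α := (ℕ × List Bool) × ℕ) (β := ℕ))) .snd
    have hz := M.sim_computable.comp hi hy
    have hc := Computable.decideEq (Computable.listTake (Computable.list_length.comp hz) hx)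
      (Computable.listTake (Computable.list_length.comp hx) hz)
    have hr : Computable fun q : ((ℕ × List Bool) × ℕ) × ℕ =>
        !r q.1.1.1 q.1.1.2 (bitString q.1.2 q.2) :=
      ((hB.comp hi hy).boolOr hc.boolNot).boolNot
    have h := Computable.decideExistsLT (α := (ℕ × List Bool) × ℕ)
      (p := fun q j => !r q.1.1 q.1.2 (bitString q.2 j))
      (Computable.twoPow .snd) hr
    exact uniformlyEffectivelyOpen_of_computable
      (B := fun i x s => !decide (∃ j < 2 ^ s, (!r i x (bitString s j)) = true)) h.boolNot
  have hm : ∀ i, imageDistribution P F {β | ∃ m s,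
      (!decide (∃ j < 2 ^ s, (!r i (initSeg β m) (bitString s j)) = true)) = true} ≤
      2 ^ 2 * 2⁻¹ ^ i := by
    intro i
    rw [imageDistribution_apply hP hFm (hV.isOpen i).measurableSet]
    calc _ ≤ P (U i ∪ G i) := by
          refine measure_mono ?_
          rintro ω ⟨hω, m, s, h⟩
          by_contra hωH
          have hωU : ω ∉ U i := fun h => hωH (Or.inl h)
          obtain ⟨j, hj, e⟩ := exists_bitString ω s
          simp only [Bool.not_eq_true', decide_eq_false_iff_not, not_exists, not_and] at h
          have hr := h j hj
          rw [e] at hr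
          simp only [r, Bool.not_eq_false, Bool.or_eq_true, Bool.not_eq_true'] at hr
          rcases hr with hr | hr
          · exact hωH ((hHB i).superset ⟨s, hr⟩)
          · rw [consistent_of_mem_cyl (mem_cyl_initSeg _ m)
              ((hM i ⟨ω, hω⟩ hωU).mem_cyl_sim s)] at hr
            exact absurd hr (by simp)
      _ ≤ 2⁻¹ ^ i + 2 * 2⁻¹ ^ i :=
          (measure_union_le _ _).trans (add_le_add (hU.measure_le i) (hGm i))
      _ ≤ 2 ^ 2 * 2⁻¹ ^ i := by
          rw [← one_add_mul]
          gcongr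
          norm_num
  obtain ⟨i, hi⟩ := hβ.eventually_notMem hV hm
  have hβi := hi i le_rfl
  have hbad : ∀ n, ∃ j < 2 ^ n, r i (initSeg β n) (bitString n j) = false := by
    intro n
    by_contra hn
    refine hβi ⟨n, n, ?_⟩
    simpa using hn
  -- The sequences on which nothing goes wrong up to stage `n`.
  let K : ℕ → Set Cantor := fun n => {ω | r i (initSeg β n) (initSeg ω n) = false}
  have hK : (⋂ n, K n).Nonempty := by
    refine IsCompact.nonempty_iInter_of_sequence_nonempty_isCompact_isClosed K
      (fun n ω hω => ?_) (fun n => ?_) ?_ fun n => ?_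
    · exact hrmono (initSeg_prefix β n.le_succ) (initSeg_prefix ω n.le_succ) hω
    · obtain ⟨j, -, hr⟩ := hbad n
      obtain ⟨ω, hω⟩ := exists_mem_cyl (bitString n j)
      rw [mem_cyl_iff, length_bitString] at hω
      exact ⟨ω, by simpa [K, hω] using hr⟩
    · exact (isClopen_initSeg 0 fun y => r i (initSeg β 0) y = false).isClosed.isCompact
    · exact (isClopen_initSeg n fun y => r i (initSeg β n) y = false).isClosed
  obtain ⟨ω, hω⟩ := hK
  have hω' : ∀ n, B i (initSeg ω n) = false ∧
      consistent (initSeg β n) (M.sim i (initSeg ω n)) = true := by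
    intro n
    have h := Set.mem_iInter.1 hω n
    simpa [K, r] using h
  have hωH : ω ∉ U i ∪ G i := by
    intro h
    obtain ⟨m, hmB⟩ := (hHB i).subset h
    simp [(hω' m).1] at hmB
  have hωr : IsMLRandom P ω := not_not.1 fun h => hωH (Or.inr (hGu ω h i))
  have hcomp := hM i ⟨ω, hωr⟩ fun h => hωH (Or.inl h)
  refine ⟨⟨ω, hωr⟩, funext fun m => ?_⟩
  obtain ⟨n, hn⟩ := hcomp.exists_le_length_sim (m + 1)
  have hn' : m < (M.sim i (initSeg ω (max n (m + 1)))).length :=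
    lt_of_lt_of_le hn (M.sim_mono i (initSeg_prefix ω (le_max_left _ _))).length_le
  have h := consistent_iff.1 (hω' (max n (m + 1))).2 m
    (by simp) hn'
  rw [hcomp.mem_cyl_sim _ m hn', ← h, getElem_initSeg]

end LayerwiseComputable

end ImageRandomness

theorem mainTheorem1 (P : MeasureTheory.Measure ImageRandomness.Cantor)
    [MeasureTheory.IsProbabilityMeasure P]
    (hP : ImageRandomness.IsComputableDistribution P)
    (F : {ω : ImageRandomness.Cantor // ImageRandomness.IsMLRandom P ω} → ImageRandomness.Cantor)
    (hF : ImageRandomness.IsLayerwiseComputable P F) :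
    -- the image distribution is well defined: a probability measure with `Q(X) = P(F⁻¹(X))`
    (MeasureTheory.IsProbabilityMeasure (ImageRandomness.imageDistribution P F) ∧
      ∀ X : Set ImageRandomness.Cantor, MeasurableSet X →
        MeasurableSet (ImageRandomness.preimageSet F X) ∧
        ImageRandomness.imageDistribution P F X = P (ImageRandomness.preimageSet F X)) ∧
    -- (i)
    ImageRandomness.IsComputableDistribution (ImageRandomness.imageDistribution P F) ∧
    -- (ii)
    (∀ α : {ω : ImageRandomness.Cantor // ImageRandomness.IsMLRandom P ω},
      ImageRandomness.IsMLRandom (ImageRandomness.imageDistribution P F) (F α)) ∧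
    -- (iii)
    (∀ β : ImageRandomness.Cantor,
      ImageRandomness.IsMLRandom (ImageRandomness.imageDistribution P F) β →
      ∃ α : {ω : ImageRandomness.Cantor // ImageRandomness.IsMLRandom P ω}, F α = β) := by
  have hFm := hF.measurable
  exact ⟨⟨ImageRandomness.isProbabilityMeasure_imageDistribution hP hFm, fun X hX =>
      ⟨ImageRandomness.measurableSet_preimageSet hP hFm hX,
        ImageRandomness.imageDistribution_apply hP hFm hX⟩⟩,
    ImageRandomness.isComputableDistribution_imageDistribution hP hF,
    ImageRandomness.isMLRandom_image hP hF,
    fun _ hβ => ImageRandomness.exists_isMLRandom_eq hP hF hβ⟩
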